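/- Let $K$ be a field of characteristic $0$, let $n\ge 2$ and $q\in K\setminus\{0\}$. Let $K\langle D\rangle$ be the free associative unital $K$-algebra on $D=\{D_{ij} : 1\le i,j\le n\}$, and let $S\subset K\langle D\rangle$ be the set of all elements $$\begin{array}{ll} D_{ij}D_{st}-qD_{st}D_{ij} & (i>s,\ j\le t),\\ D_{ij}D_{st}-D_{st}D_{ij}-(q-1)D_{sj}D_{it} & (i>s,\ j>t),\\ D_{ij}D_{ik}-D_{ik}D_{ij} & (\text{all } i,j,k). \end{array}$$ Let $J=\langle S\rangle$ be the two-sided ideal generated by $S$, let $D_q(n)=K\langle D\rangle/J$ be the (Dipper--Donkin) quantized matrix algebra, and let $d_{ij}$ be the class of $D_{ij}$. Order the generators lexicographically by their indices ($D_{kl}<D_{ij}$ iff $k<i$, or $k=i$ and $l<j$), and order the words in $D$ by the induced degree-lexicographic ordering (first by length, then lexicographically from the left). Then the ordered monomials $$d_{11}^{k_{11}}d_{12}^{k_{12}}\cdots d_{1n}^{k_{1n}}d_{21}^{k_{21}}\cdots d_{2n}^{k_{2n}}\cdots d_{n1}^{k_{n1}}\cdots d_{nn}^{k_{nn}},\qquad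 k_{ij}\in\mathbb N=\{0,1,2,\dots\},$$ indexed by the families $(k_{ij})$, form a $K$-basis of $D_q(n)$ (the PBW basis). Moreover, $S$ is a Gröbner--Shirshov basis of $J$ (every composition of intersection or of inclusion $(f,g)_w$ of nonzero elements of $S$, made monic, is trivial modulo $(S,w)$, that is, a linear combination of elements $a s b$ with $s\in S$ nonzero, $a,b$ words and $a\bar s b$ smaller than $w$, where $\bar s$ is the leading word of $s$), and the normal words modulo $S$ (the words having no subword that is the leading word of a nonzero element of $S$) are exactly the words $D_{11}^{k_{11}}D_{12}^{k_{12}}\cdots D_{nn}^{k_{nn}}$ with $k_{ij}\in\mathbb N$, the factors again in lexicographic order of their indices. -/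

import Mathlib

namespace QuantizedMatrix

noncomputable section

/-! ### Words, leading words and Gröbner–Shirshov bases in a free associative algebra -/

section GroebnerShirshov

variable {K X : Type*} [Field K]

/-- The word `w`, regarded as an element of the free algebra `K⟨X⟩`. -/
def word (K : Type*) {X : Type*} [Field K] (w : FreeMonoid X) : FreeAlgebra K X :=
  FreeMonoid.lift (FreeAlgebra.ι K) w

/-- The coefficient of the word `w` in `f`, with respect to the basis of `K⟨X⟩` given by all
words. -/
def wordCoeff (f : FreeAlgebra K X) (w : FreeMonoid X) : K :=
  (FreeAlgebra.equivMonoidAlgebraFreeMonoid f).coeff w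

/-- The deg-lex ordering on words: compare lengths first, then lexicographically from the left. -/
def DegLexLT [LinearOrder X] (u v : FreeMonoid X) : Prop :=
  List.Shortlex (· < ·) u.toList v.toList

/-- `u` is the leading word of `f` for the deg-lex ordering (so `f ≠ 0`). -/
def IsLeadingWord [LinearOrder X] (f : FreeAlgebra K X) (u : FreeMonoid X) : Prop :=
  wordCoeff f u ≠ 0 ∧ ∀ v, wordCoeff f v ≠ 0 → v ≠ u → DegLexLT v u

/-- A word is normal modulo `S` if no leading word of a (nonzero) element of `S` is a subword
of it. -/
def IsNormalWord [LinearOrder X] (S : Set (FreeAlgebra K X)) (w : FreeMonoid X) : Prop :=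
  ∀ f ∈ S, ∀ u, IsLeadingWord f u → ¬ ∃ a b : FreeMonoid X, w = a * u * b

/-- The linear combinations of elements `a s b`, with `s ∈ S` and words `a`, `b`, whose leading
word `a s̄ b` is smaller than `w`. An element is trivial modulo `(S, w)` if it lies in here. -/
def trivialMod [LinearOrder X] (S : Set (FreeAlgebra K X)) (w : FreeMonoid X) :
    Submodule K (FreeAlgebra K X) :=
  Submodule.span K {p | ∃ s ∈ S, ∃ u a b : FreeMonoid X,
    IsLeadingWord s u ∧ DegLexLT (a * u * b) w ∧ p = word K a * s * word K b}

/-- `S` is a Gröbner–Shirshov basis (of the ideal that it generates) for the deg-lex ordering: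
all compositions of intersection and of inclusion of elements of `S`, made monic, are trivial
modulo `S`. -/
structure IsGroebnerShirshov [LinearOrder X] (S : Set (FreeAlgebra K X)) : Prop where
  intersection : ∀ f ∈ S, ∀ g ∈ S, ∀ u v a b w : FreeMonoid X,
    IsLeadingWord f u → IsLeadingWord g v → w = u * b → w = a * v →
    w.length < u.length + v.length →
    (wordCoeff f u)⁻¹ • (f * word K b) - (wordCoeff g v)⁻¹ • (word K a * g) ∈ trivialMod S w
  inclusion : ∀ f ∈ S, ∀ g ∈ S, ∀ u v a b w : FreeMonoid X,
    IsLeadingWord f u → IsLeadingWord g v → w = u → w = a * v * b →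
    (wordCoeff f u)⁻¹ • f - (wordCoeff g v)⁻¹ • (word K a * g * word K b) ∈ trivialMod S w

end GroebnerShirshov

/-! ### The quantized matrix algebra -/

/-- The index set of the generators, with the lexicographic order. -/
abbrev Idx (n : ℕ) : Type := Fin n ×ₗ Fin n

/-- The free generator `D i j` of `K⟨D⟩`. -/
def D (K : Type*) [Field K] {n : ℕ} (i j : Fin n) : FreeAlgebra K (Idx n) :=
  FreeAlgebra.ι K (toLex (i, j))

/-- The set `S` of defining relations of `D_q(n)` in `K⟨D⟩`. -/
def relations {K : Type*} [Field K] (n : ℕ) (q : K) : Set (FreeAlgebra K (Idx n)) :=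
  {f | ∃ i j s t : Fin n, s < i ∧ j ≤ t ∧ f = D K i j * D K s t - q • (D K s t * D K i j)} ∪
  {f | ∃ i j s t : Fin n, s < i ∧ t < j ∧
    f = D K i j * D K s t - D K s t * D K i j - (q - 1) • (D K s j * D K i t)} ∪
  {f | ∃ i j k : Fin n, f = D K i j * D K i k - D K i k * D K i j}

/-- The two-sided ideal `J` of `K⟨D⟩` generated by `S`. -/
def relIdeal {K : Type*} [Field K] (n : ℕ) (q : K) : TwoSidedIdeal (FreeAlgebra K (Idx n)) :=
  TwoSidedIdeal.span (relations n q)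

/-- The quantized matrix algebra `D_q(n) = K⟨D⟩ / J`. -/
abbrev QMatAlg {K : Type*} [Field K] (n : ℕ) (q : K) : Type _ :=
  (relIdeal n q).ringCon.Quotient

/-- The generator `d i j` of `D_q(n)`, the class of `D i j`. -/
def d {K : Type*} [Field K] {n : ℕ} (q : K) (i j : Fin n) : QMatAlg n q :=
  (relIdeal n q).ringCon.mkₐ (α := K) (D K i j)

/-- The product, in lexicographic order of the indices,
`x 1 1 ^ k 1 1 * x 1 2 ^ k 1 2 * ⋯ * x 1 n ^ k 1 n * x 2 1 ^ k 2 1 * ⋯ * x n n ^ k n n`. -/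
def orderedProd {M : Type*} [Monoid M] {n : ℕ} (x : Fin n → Fin n → M)
    (k : Fin n → Fin n → ℕ) : M :=
  ((List.finRange n).map fun i => ((List.finRange n).map fun j => x i j ^ k i j).prod).prod

end

end QuantizedMatrix

/-!
The proof follows Shirshov's composition-diamond lemma (Bergman's diamond lemma).

Let `S` be a Gröbner–Shirshov basis. Two occurrences of leading words of `S` in a word `w` are
disjoint, overlapping or nested. In the first case the corresponding monic multiples of elements
of `S` agree, up to multiples with leading word smaller than `w`, for trivial reasons; in the
other two cases because the compositions are trivial (`IsGroebnerShirshov.sub_mem_trivialMod`).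
Hence a nonzero element of the ideal can be written as one multiple of an element of `S`, with
nonzero coefficient, plus multiples with smaller leading words, so that its leading word is not
normal (`IsGroebnerShirshov.exists_not_isNormalWord`): normal words are linearly independent modulo
the ideal. They span the quotient because a word that is not normal is congruent to a combination
of smaller words and the deg-lex ordering is well-founded (`span_normalWords`).

For the quantized matrix algebra, the leading words of the relations are the words `x y` with
`y < x`, and the relation, made monic, is determined by its leading word
(`exists_eq_of_isLeadingWord`). So all compositions of inclusion vanish, the nontrivial compositions
of intersection belong to words `x y z` with `z < y < x`, and the normal words are the sorted ones
(`isNormalWord_relations_iff`). For generators in distinct rows the relation has the uniform shape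
`D_{ij} D_{st} = α D_{st} D_{ij} + β D_{sj} D_{it}`, where `α`, `β` depend only on whether `j ≤ t`.
Sorting the three rows of `x y z` in the two possible ways gives the same result: if the rows are
distinct this is the Yang–Baxter equation for the coefficients `α`, `β`, and if some rows agree the
two results differ by commutators inside a row, which are relations too. Each of the
four row patterns is one of the `composition_…` lemmas, and the comparison of the columns is a
finite check.
-/

namespace QuantizedMatrix

noncomputable section

/-! ### Words and their coefficients -/

section Words

variable {K X : Type*} [Field K]

theorem word_mul (u v : FreeMonoid X) : word K (u * v) = word K u * word K v := map_mul _ u v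

theorem word_one : word K (1 : FreeMonoid X) = 1 := map_one _

theorem word_eq_basis (u : FreeMonoid X) : word K u = FreeAlgebra.basisFreeMonoid K X u := by
  simp [word, FreeAlgebra.basisFreeMonoid, FreeAlgebra.equivMonoidAlgebraFreeMonoid]

theorem wordCoeff_eq_repr (f : FreeAlgebra K X) (u : FreeMonoid X) :
    wordCoeff f u = (FreeAlgebra.basisFreeMonoid K X).repr f u := rfl

theorem mem_span_range_word (f : FreeAlgebra K X) :
    f ∈ Submodule.span K (Set.range (word K (X := X))) := by
  have : word K (X := X) = FreeAlgebra.basisFreeMonoid K X := funext word_eq_basis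
  rw [this, Module.Basis.span_eq]
  trivial

@[simp]
theorem wordCoeff_sub (f g : FreeAlgebra K X) (u : FreeMonoid X) :
    wordCoeff (f - g) u = wordCoeff f u - wordCoeff g u := by
  simp [wordCoeff_eq_repr]

@[simp]
theorem wordCoeff_smul (c : K) (f : FreeAlgebra K X) (u : FreeMonoid X) :
    wordCoeff (c • f) u = c * wordCoeff f u := by
  simp [wordCoeff_eq_repr]

open scoped Classical in
theorem wordCoeff_word (u v : FreeMonoid X) :
    wordCoeff (word K u) v = if u = v then 1 else 0 := by
  rw [word_eq_basis, wordCoeff_eq_repr, Module.Basis.repr_self, Finsupp.single_apply]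

theorem mem_span_word_iff {U : Set (FreeMonoid X)} {f : FreeAlgebra K X} :
    f ∈ Submodule.span K (word K '' U) ↔ ∀ v, wordCoeff f v ≠ 0 → v ∈ U := by
  have : word K (X := X) = FreeAlgebra.basisFreeMonoid K X := funext word_eq_basis
  rw [this, Module.Basis.mem_span_image]
  simp [Set.subset_def, wordCoeff_eq_repr]

end Words

/-! ### The deg-lex ordering -/

section DegLex

variable {X : Type*} [LinearOrder X]

namespace DegLexLT

theorem iff_lt {u v : FreeMonoid X} : DegLexLT u v ↔
    u.length < v.length ∨ u.length = v.length ∧ u.toList < v.toList :=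
  List.shortlex_def

theorem trans {u v w : FreeMonoid X} (h₁ : DegLexLT u v) (h₂ : DegLexLT v w) : DegLexLT u w := by
  rw [iff_lt] at *
  rcases h₁ with h₁ | ⟨h₁, h₁'⟩ <;> rcases h₂ with h₂ | ⟨h₂, h₂'⟩
  · exact .inl (h₁.trans h₂)
  · exact .inl (h₂ ▸ h₁)
  · exact .inl (h₁ ▸ h₂)
  · exact .inr ⟨h₁.trans h₂, h₁'.trans h₂'⟩

theorem irrefl (u : FreeMonoid X) : ¬ DegLexLT u u := by
  simp [iff_lt]

theorem trichotomy (u v : FreeMonoid X) : DegLexLT u v ∨ u = v ∨ DegLexLT v u := by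
  simp only [iff_lt]
  rcases lt_trichotomy u.length v.length with h | h | h
  · exact .inl (.inl h)
  · rcases lt_trichotomy u.toList v.toList with h' | h' | h'
    · exact .inl (.inr ⟨h, h'⟩)
    · exact .inr (.inl (FreeMonoid.toList.injective h'))
    · exact .inr (.inr (.inr ⟨h.symm, h'⟩))
  · exact .inr (.inr (.inl h))

theorem wellFounded [WellFoundedLT X] : WellFounded (DegLexLT (X := X)) :=
  InvImage.wf FreeMonoid.toList (List.Shortlex.wf wellFounded_lt)

theorem mul_left {u v : FreeMonoid X} (h : DegLexLT u v) (a : FreeMonoid X) :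
    DegLexLT (a * u) (a * v) :=
  List.Shortlex.append_left h a.toList

theorem mul_right {u v : FreeMonoid X} (h : DegLexLT u v) (b : FreeMonoid X) :
    DegLexLT (u * b) (v * b) := by
  have key : ∀ {l m : List X}, l.length = m.length → List.Lex (· < ·) l m →
      List.Lex (· < ·) (l ++ b.toList) (m ++ b.toList) := by
    intro l m hl h
    induction h with
    | nil => simp at hl
    | cons _ ih => exact List.Lex.cons (ih (by simpa using hl))
    | rel h => exact List.Lex.rel h
  rcases List.shortlex_def.1 h with h | ⟨h, h'⟩
  · refine List.Shortlex.of_length_lt ?_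
    simpa using h
  · exact List.Shortlex.of_lex (by simpa using h) (key h h')

theorem mul {u v : FreeMonoid X} (h : DegLexLT u v) (a b : FreeMonoid X) :
    DegLexLT (a * u * b) (a * v * b) :=
  (h.mul_left a).mul_right b

end DegLexLT

end DegLex

/-! ### Leading words -/

section LeadingWords

variable {K X : Type*} [Field K] [LinearOrder X]

/-- The linear combinations of words smaller than `w`. -/
def below (K : Type*) [Field K] (w : FreeMonoid X) : Submodule K (FreeAlgebra K X) :=
  Submodule.span K (word K '' {v | DegLexLT v w})

theorem mem_below_iff {f : FreeAlgebra K X} {w : FreeMonoid X} :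
    f ∈ below K w ↔ ∀ v, wordCoeff f v ≠ 0 → DegLexLT v w :=
  mem_span_word_iff

theorem word_mem_below {v w : FreeMonoid X} (h : DegLexLT v w) : word K v ∈ below K w :=
  Submodule.subset_span ⟨v, h, rfl⟩

theorem below_mono {v w : FreeMonoid X} (h : DegLexLT v w) : below K v ≤ below K w :=
  Submodule.span_mono (Set.image_mono fun _ hu => hu.trans h)

theorem mul_mem_below {f : FreeAlgebra K X} {w : FreeMonoid X} (hf : f ∈ below K w)
    (a b : FreeMonoid X) : word K a * f * word K b ∈ below K (a * w * b) := by
  induction hf using Submodule.span_induction with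
  | mem f hf =>
    obtain ⟨v, hv, rfl⟩ := hf
    rw [← word_mul, ← word_mul]
    exact word_mem_below (DegLexLT.mul hv a b)
  | zero => simp
  | add f g _ _ hf hg =>
    rw [mul_add, add_mul]
    exact add_mem hf hg
  | smul c f _ hf =>
    rw [mul_smul_comm, smul_mul_assoc]
    exact Submodule.smul_mem _ c hf

theorem isLeadingWord_of_sub_mem {f : FreeAlgebra K X} {u : FreeMonoid X} {c : K} (hc : c ≠ 0)
    (h : f - c • word K u ∈ below K u) : wordCoeff f u = c ∧ IsLeadingWord f u := by
  rw [mem_below_iff] at h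
  have hu : wordCoeff f u = c := by
    by_contra hne
    refine DegLexLT.irrefl u (h u ?_)
    simpa [wordCoeff_word, sub_eq_zero] using hne
  refine ⟨hu, hu ▸ hc, fun v hv hvu => h v ?_⟩
  simpa [wordCoeff_word, hvu.symm] using hv

theorem IsLeadingWord.unique {f : FreeAlgebra K X} {u v : FreeMonoid X}
    (hu : IsLeadingWord f u) (hv : IsLeadingWord f v) : u = v := by
  by_contra h
  exact DegLexLT.irrefl u ((hv.2 u hu.1 h).trans (hu.2 v hv.1 (Ne.symm h)))

theorem IsLeadingWord.sub_mem {f : FreeAlgebra K X} {u : FreeMonoid X} (h : IsLeadingWord f u) :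
    (wordCoeff f u)⁻¹ • f - word K u ∈ below K u := by
  rw [mem_below_iff]
  intro v hv
  by_cases huv : u = v
  · subst huv
    simp [wordCoeff_word, h.1] at hv
  · refine h.2 v ?_ (Ne.symm huv)
    simp only [wordCoeff_sub, wordCoeff_smul, wordCoeff_word, huv, if_false, sub_zero] at hv
    exact right_ne_zero_of_mul hv

theorem exists_isLeadingWord {f : FreeAlgebra K X} (hf : f ≠ 0) : ∃ u, IsLeadingWord f u := by
  classical
  have key : ∀ s : Finset (FreeMonoid X), s.Nonempty →
      ∃ u ∈ s, ∀ v ∈ s, v ≠ u → DegLexLT v u := by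
    intro s hs
    induction hs using Finset.Nonempty.cons_induction with
    | singleton a => exact ⟨a, by simp, by simp⟩
    | cons a s ha hs ih =>
      obtain ⟨u, hu, h⟩ := ih
      rcases DegLexLT.trichotomy a u with hau | rfl | hau
      · refine ⟨u, by simp [hu], fun v hv hvu => ?_⟩
        rcases Finset.mem_cons.1 hv with rfl | hv
        · exact hau
        · exact h v hv hvu
      · exact absurd hu ha
      · refine ⟨a, by simp, fun v hv hva => ?_⟩
        rcases Finset.mem_cons.1 hv with rfl | hv
        · exact absurd rfl hva
        · by_cases hvu : v = u
          · exact hvu ▸ hau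
          · exact (h v hv hvu).trans hau
  obtain ⟨u, hu, h⟩ := key ((FreeAlgebra.basisFreeMonoid K X).repr f).support
    (by simpa using hf)
  exact ⟨u, Finsupp.mem_support_iff.1 hu, fun v hv => h v (Finsupp.mem_support_iff.2 hv)⟩

end LeadingWords

/-! ### The composition-diamond lemma -/

section Diamond

variable {K X : Type*} [Field K] [LinearOrder X] {S : Set (FreeAlgebra K X)}

/-- The linear combinations of elements `a s b`, with `s ∈ S` and words `a`, `b`, whose leading
word `a s̄ b` lies in `U`. For `U` the words smaller than `w` this is `trivialMod S w`. -/
def multiplesIn (S : Set (FreeAlgebra K X)) (U : Set (FreeMonoid X)) :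
    Submodule K (FreeAlgebra K X) :=
  Submodule.span K {p | ∃ s ∈ S, ∃ u a b : FreeMonoid X,
    IsLeadingWord s u ∧ a * u * b ∈ U ∧ p = word K a * s * word K b}

theorem mem_multiplesIn {U : Set (FreeMonoid X)} {s : FreeAlgebra K X} (hs : s ∈ S)
    {u : FreeMonoid X} (hu : IsLeadingWord s u) {a b : FreeMonoid X} (h : a * u * b ∈ U) :
    word K a * s * word K b ∈ multiplesIn S U :=
  Submodule.subset_span ⟨s, hs, u, a, b, hu, h, rfl⟩

theorem trivialMod_eq (S : Set (FreeAlgebra K X)) (w : FreeMonoid X) :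
    trivialMod S w = multiplesIn S {v | DegLexLT v w} := rfl

theorem mem_trivialMod {s : FreeAlgebra K X} (hs : s ∈ S) {u : FreeMonoid X}
    (hu : IsLeadingWord s u) {a b w : FreeMonoid X} (h : DegLexLT (a * u * b) w) :
    word K a * s * word K b ∈ trivialMod S w := by
  rw [trivialMod_eq]
  exact mem_multiplesIn hs hu h

theorem multiplesIn_mono {U V : Set (FreeMonoid X)} (h : U ⊆ V) :
    multiplesIn S U ≤ multiplesIn S V :=
  Submodule.span_mono fun _ ⟨s, hs, u, a, b, hu, hw, hp⟩ => ⟨s, hs, u, a, b, hu, h hw, hp⟩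

theorem trivialMod_mono {v w : FreeMonoid X} (h : DegLexLT v w) :
    trivialMod S v ≤ trivialMod S w := by
  rw [trivialMod_eq, trivialMod_eq]
  exact multiplesIn_mono fun _ hu => DegLexLT.trans hu h

theorem mul_mem_multiplesIn {U V : Set (FreeMonoid X)} {a b : FreeMonoid X}
    (h : ∀ u ∈ U, a * u * b ∈ V) {f : FreeAlgebra K X} (hf : f ∈ multiplesIn S U) :
    word K a * f * word K b ∈ multiplesIn S V := by
  induction hf using Submodule.span_induction with
  | mem f hf =>
    obtain ⟨s, hs, u, a', b', hu, hw, rfl⟩ := hf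
    have : word K a * (word K a' * s * word K b') * word K b =
        word K (a * a') * s * word K (b' * b) := by
      simp only [word_mul, mul_assoc]
    rw [this]
    refine mem_multiplesIn hs hu ?_
    have := h _ hw
    simpa only [mul_assoc] using this
  | zero => simp
  | add f g _ _ hf hg =>
    rw [mul_add, add_mul]
    exact add_mem hf hg
  | smul c f _ hf =>
    rw [mul_smul_comm, smul_mul_assoc]
    exact Submodule.smul_mem _ c hf

theorem mul_mem_trivialMod {w : FreeMonoid X} {f : FreeAlgebra K X} (hf : f ∈ trivialMod S w)
    (a b : FreeMonoid X) : word K a * f * word K b ∈ trivialMod S (a * w * b) := by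
  rw [trivialMod_eq] at hf ⊢
  exact mul_mem_multiplesIn (fun _ hu => DegLexLT.mul hu a b) hf

theorem smul_sub_smul_mem_trivialMod {w : FreeMonoid X} {f g : FreeAlgebra K X} {c k : K}
    (h : c • f - k • g ∈ trivialMod S w) (a b : FreeMonoid X) :
    c • (word K a * f * word K b) - k • (word K a * g * word K b) ∈ trivialMod S (a * w * b) := by
  convert mul_mem_trivialMod h a b using 1
  rw [mul_sub, sub_mul, mul_smul_comm, smul_mul_assoc, mul_smul_comm, smul_mul_assoc]

theorem trivialMod_le_below (w : FreeMonoid X) : trivialMod S w ≤ below K w := by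
  refine Submodule.span_le.2 ?_
  rintro _ ⟨s, hs, u, a, b, hu, hw, rfl⟩
  have h₁ := below_mono hw (mul_mem_below hu.sub_mem a b)
  have h₂ := add_mem h₁ (word_mem_below (K := K) hw)
  have h₃ := Submodule.smul_mem _ (wordCoeff s u) h₂
  convert h₃ using 1
  simp [mul_sub, sub_mul, word_mul, smul_smul, hu.1]

/-- Two multiples of elements of `S`, at disjoint subwords of a word, agree up to smaller
multiples. -/
theorem disjoint_mem_trivialMod {f g : FreeAlgebra K X} (hf : f ∈ S) (hg : g ∈ S)
    {u v : FreeMonoid X} (hu : IsLeadingWord f u) (hv : IsLeadingWord g v) (d : FreeMonoid X) :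
    (wordCoeff f u)⁻¹ • (f * word K (d * v)) - (wordCoeff g v)⁻¹ • (word K (u * d) * g) ∈
      trivialMod S (u * d * v) := by
  -- Write the monic elements as `F = u + p` and `G = v + r`; then `F d v - u d G = p d G - F d r`.
  set F := (wordCoeff f u)⁻¹ • f with hF
  set G := (wordCoeff g v)⁻¹ • g with hG
  have hp : F - word K u ∈ below K u := hu.sub_mem
  have hr : G - word K v ∈ below K v := hv.sub_mem
  have h₁ : (F - word K u) * (word K d * G) ∈ trivialMod S (u * d * v) := by
    generalize F - word K u = p at hp
    induction hp using Submodule.span_induction with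
    | mem p hp =>
      obtain ⟨w, hw, rfl⟩ := hp
      rw [hG, mul_smul_comm, mul_smul_comm]
      have := mem_trivialMod (K := K) hg hv (a := w * d) (b := 1) (w := u * d * v)
        (by simpa only [mul_assoc, mul_one] using DegLexLT.mul_right hw (d * v))
      exact Submodule.smul_mem _ _ (by simpa [word_mul, word_one, mul_assoc] using this)
    | zero => simp
    | add p q _ _ hp hq =>
      rw [add_mul]
      exact add_mem hp hq
    | smul c p _ hp =>
      rw [smul_mul_assoc]
      exact Submodule.smul_mem _ c hp
  have h₂ : F * (word K d * (G - word K v)) ∈ trivialMod S (u * d * v) := by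
    generalize G - word K v = r at hr
    induction hr using Submodule.span_induction with
    | mem r hr =>
      obtain ⟨w, hw, rfl⟩ := hr
      rw [hF, smul_mul_assoc]
      have := mem_trivialMod (K := K) hf hu (a := 1) (b := d * w) (w := u * d * v)
        (by simpa only [mul_assoc, one_mul] using DegLexLT.mul_left hw (u * d))
      exact Submodule.smul_mem _ _ (by simpa [word_mul, word_one, mul_assoc] using this)
    | zero => simp
    | add p q _ _ hp hq =>
      rw [mul_add, mul_add]
      exact add_mem hp hq
    | smul c p _ hp =>
      rw [mul_smul_comm, mul_smul_comm]
      exact Submodule.smul_mem _ c hp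
  rw [← smul_mul_assoc, ← mul_smul_comm, ← hF, ← hG]
  convert sub_mem h₁ h₂ using 1
  simp only [word_mul, mul_sub, sub_mul, mul_assoc]
  abel

/-- For a Gröbner–Shirshov basis `S`, all monic multiples of elements of `S` with the same leading
word agree up to smaller multiples. -/
theorem IsGroebnerShirshov.sub_mem_trivialMod (hS : IsGroebnerShirshov S)
    {f g : FreeAlgebra K X} (hf : f ∈ S) (hg : g ∈ S) {u v : FreeMonoid X}
    (hu : IsLeadingWord f u) (hv : IsLeadingWord g v) {a b a' b' : FreeMonoid X}
    (h : a * u * b = a' * v * b') :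
    (wordCoeff f u)⁻¹ • (word K a * f * word K b) -
      (wordCoeff g v)⁻¹ • (word K a' * g * word K b') ∈ trivialMod S (a * u * b) := by
  wlog hlen : a.length ≤ a'.length generalizing f g u v a b a' b'
  · rw [h, ← neg_mem_iff, neg_sub]
    exact this hg hf hv hu h.symm (le_of_not_ge hlen)
  have split : ∀ {p q r s : FreeMonoid X}, p * q = r * s → p.length ≤ r.length →
      ∃ c, r = p * c ∧ q = c * s := by
    intro p q r s hpq hpr
    rcases List.append_eq_append_iff.1 (show p.toList ++ q.toList = r.toList ++ s.toList from hpq)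
      with ⟨c, hc, hc'⟩ | ⟨c, hc, hc'⟩
    · exact ⟨c, hc, hc'⟩
    · have : c = [] := by
        have := congrArg List.length hc
        rw [List.length_append] at this
        have hpr' : p.toList.length ≤ r.toList.length := hpr
        exact List.length_eq_zero_iff.1 (by omega)
      subst this
      exact ⟨1, by simpa using hc.symm, by simpa using hc'.symm⟩
  rw [mul_assoc, mul_assoc] at h
  obtain ⟨c, rfl, hc⟩ := split h hlen
  rcases le_total u.length c.length with huc | huc
  · -- the two subwords are disjoint
    obtain ⟨d, rfl, rfl⟩ := split hc huc
    have := smul_sub_smul_mem_trivialMod (disjoint_mem_trivialMod hf hg hu hv d) a b'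
    simpa only [word_mul, mul_assoc] using this
  · obtain ⟨e, rfl, he⟩ := split hc.symm huc
    rcases le_total v.length e.length with hve | hve
    · -- the second subword lies in the first one
      obtain ⟨k, rfl, rfl⟩ := split he hve
      have := smul_sub_smul_mem_trivialMod (hS.inclusion f hf g hg _ v c k _ hu hv rfl
        (mul_assoc c v k).symm) a b
      simpa only [word_mul, mul_assoc] using this
    · obtain ⟨k, rfl, rfl⟩ := split he.symm hve
      rcases Nat.eq_zero_or_pos e.length with he0 | he0
      · -- the two subwords are adjacent
        obtain rfl : e = 1 := FreeMonoid.length_eq_zero.1 he0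
        have := smul_sub_smul_mem_trivialMod (disjoint_mem_trivialMod hf hg hu hv 1) a b'
        simpa only [word_mul, word_one, mul_assoc, mul_one, one_mul] using this
      · -- the two subwords overlap
        have := smul_sub_smul_mem_trivialMod (hS.intersection f hf g hg _ _ c k _ hu hv rfl
          (mul_assoc c e k) (by simp only [FreeMonoid.length_mul]; omega)) a b'
        simpa only [word_mul, mul_assoc] using this

/-- A combination of multiples of elements of a Gröbner–Shirshov basis can be rewritten so that the
largest leading word comes from one multiple only. -/
theorem IsGroebnerShirshov.exists_sub_mem_trivialMod (hS : IsGroebnerShirshov S)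
    {U : Set (FreeMonoid X)} {f : FreeAlgebra K X} (hf : f ∈ multiplesIn S U) :
    f = 0 ∨ ∃ s ∈ S, ∃ u a b : FreeMonoid X, ∃ c : K, IsLeadingWord s u ∧ a * u * b ∈ U ∧
      f - c • (wordCoeff s u)⁻¹ • (word K a * s * word K b) ∈ trivialMod S (a * u * b) := by
  induction hf using Submodule.span_induction with
  | mem f hf =>
    obtain ⟨s, hs, u, a, b, hu, hw, rfl⟩ := hf
    refine .inr ⟨s, hs, u, a, b, wordCoeff s u, hu, hw, ?_⟩
    rw [smul_inv_smul₀ hu.1, sub_self]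
    exact zero_mem _
  | zero => exact .inl rfl
  | add f g _ _ hf hg =>
    rcases hf with rfl | ⟨s, hs, u, a, b, c, hu, hw, h⟩
    · simpa using hg
    rcases hg with rfl | ⟨s', hs', u', a', b', c', hu', hw', h'⟩
    · rw [add_zero]
      exact .inr ⟨s, hs, u, a, b, c, hu, hw, h⟩
    -- an element with smaller leading word is absorbed
    have absorb : ∀ {f : FreeAlgebra K X} {s : FreeAlgebra K X} {u a b w : FreeMonoid X} {c : K},
        s ∈ S → IsLeadingWord s u → DegLexLT (a * u * b) w →
        f - c • (wordCoeff s u)⁻¹ • (word K a * s * word K b) ∈ trivialMod S (a * u * b) →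
        f ∈ trivialMod S w := by
      intro f s u a b w c hs hu hw h
      rw [← sub_add_cancel f (c • (wordCoeff s u)⁻¹ • (word K a * s * word K b))]
      exact add_mem (trivialMod_mono hw h)
        (Submodule.smul_mem _ _ (Submodule.smul_mem _ _ (mem_trivialMod hs hu hw)))
    rcases DegLexLT.trichotomy (a * u * b) (a' * u' * b') with hlt | heq | hlt
    · refine .inr ⟨s', hs', u', a', b', c', hu', hw', ?_⟩
      rw [add_sub_assoc]
      exact add_mem (absorb hs hu hlt h) h'
    · refine .inr ⟨s, hs, u, a, b, c + c', hu, hw, ?_⟩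
      have := add_mem (add_mem h (heq ▸ h')) (Submodule.smul_mem _ (-c')
        (hS.sub_mem_trivialMod hs hs' hu hu' heq))
      convert this using 1
      module
    · refine .inr ⟨s, hs, u, a, b, c, hu, hw, ?_⟩
      rw [add_sub_right_comm]
      exact add_mem h (absorb hs' hu' hlt h')
  | smul k f _ hf =>
    rcases hf with rfl | ⟨s, hs, u, a, b, c, hu, hw, h⟩
    · simp
    · refine .inr ⟨s, hs, u, a, b, k * c, hu, hw, ?_⟩
      rw [mul_smul, ← smul_sub]
      exact Submodule.smul_mem _ k h

/-- A nonzero combination of multiples of elements of a Gröbner–Shirshov basis involves a word that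
is not normal (its leading word). -/
theorem IsGroebnerShirshov.exists_not_isNormalWord [WellFoundedLT X] (hS : IsGroebnerShirshov S)
    {U : Set (FreeMonoid X)} {f : FreeAlgebra K X} (hf : f ∈ multiplesIn S U) (hf0 : f ≠ 0) :
    ∃ w, wordCoeff f w ≠ 0 ∧ ¬ IsNormalWord S w := by
  have step : ∀ (V : Set (FreeMonoid X)), (∀ w ∈ V, ∀ g ∈ trivialMod S w, g ≠ 0 →
      ∃ w, wordCoeff g w ≠ 0 ∧ ¬ IsNormalWord S w) →
      ∀ g ∈ multiplesIn S V, g ≠ 0 → ∃ w, wordCoeff g w ≠ 0 ∧ ¬ IsNormalWord S w := by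
    intro V ih g hg hg0
    rcases hS.exists_sub_mem_trivialMod hg with h | ⟨s, hs, u, a, b, c, hu, hw, h⟩
    · exact absurd h hg0
    by_cases hc : c = 0
    · rw [hc, zero_smul, sub_zero] at h
      exact ih _ hw g h hg0
    refine ⟨a * u * b, ?_, fun hn => hn s hs u hu ⟨a, b, rfl⟩⟩
    have h₁ := Submodule.smul_mem _ c (mul_mem_below hu.sub_mem a b)
    have h₂ := add_mem (trivialMod_le_below _ h) h₁
    refine (isLeadingWord_of_sub_mem (c := c) hc ?_).2.1
    convert h₂ using 1
    simp only [word_mul, mul_sub, sub_mul, mul_smul_comm, smul_mul_assoc, smul_sub]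
    abel
  have key : ∀ w, ∀ g ∈ trivialMod S w, g ≠ 0 →
      ∃ w, wordCoeff g w ≠ 0 ∧ ¬ IsNormalWord S w := by
    intro w
    refine DegLexLT.wellFounded.induction
      (C := fun w => ∀ g ∈ trivialMod S w, g ≠ 0 →
        ∃ w, wordCoeff g w ≠ 0 ∧ ¬ IsNormalWord S w) w fun w ih => ?_
    rw [trivialMod_eq]
    exact step _ ih
  exact step U (fun w _ => key w) f hf hf0

end Diamond

theorem mkₐ_eq_zero_iff {K R : Type*} [Field K] [Ring R] [Algebra K R] {I : TwoSidedIdeal R}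
    {f : R} :
    I.ringCon.mkₐ (α := K) f = 0 ↔ f ∈ I := by
  rw [TwoSidedIdeal.mem_iff, ← map_zero (I.ringCon.mkₐ (α := K))]
  exact RingCon.eq _

section NormalWords

variable {K X : Type*} [Field K] [LinearOrder X] {S : Set (FreeAlgebra K X)}

theorem mem_multiplesIn_univ_of_mem_span {f : FreeAlgebra K X} (hf : f ∈ TwoSidedIdeal.span S) :
    f ∈ multiplesIn S Set.univ := by
  have hmul : ∀ g h f : FreeAlgebra K X, f ∈ multiplesIn S Set.univ →
      g * f * h ∈ multiplesIn S Set.univ := by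
    intro g h f hf
    have hg := mem_span_range_word g
    have hh := mem_span_range_word h
    induction hg using Submodule.span_induction with
    | mem g hg =>
      obtain ⟨a, rfl⟩ := hg
      induction hh using Submodule.span_induction with
      | mem h hh =>
        obtain ⟨b, rfl⟩ := hh
        exact mul_mem_multiplesIn (fun _ _ => Set.mem_univ _) hf
      | zero => simp
      | add x y _ _ hx hy =>
        rw [mul_add]
        exact add_mem hx hy
      | smul c x _ hx =>
        rw [mul_smul_comm]
        exact Submodule.smul_mem _ c hx
    | zero => simp
    | add x y _ _ hx hy =>
      rw [add_mul, add_mul]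
      exact add_mem hx hy
    | smul c x _ hx =>
      rw [smul_mul_assoc, smul_mul_assoc]
      exact Submodule.smul_mem _ c hx
  induction hf using TwoSidedIdeal.span_induction with
  | mem s hs =>
    by_cases h0 : s = 0
    · rw [h0]
      exact zero_mem _
    · obtain ⟨u, hu⟩ := exists_isLeadingWord h0
      have := mem_multiplesIn (U := Set.univ) (a := 1) (b := 1) hs hu trivial
      simpa [word_one] using this
  | zero => exact zero_mem _
  | add x y _ _ hx hy => exact add_mem hx hy
  | neg x _ hx => exact neg_mem hx
  | left_absorb a x _ hx => simpa using hmul a 1 x hx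
  | right_absorb b x _ hx => simpa using hmul 1 b x hx

theorem IsGroebnerShirshov.linearIndependent_normalWords [WellFoundedLT X]
    (hS : IsGroebnerShirshov S) :
    LinearIndependent K fun w : {w // IsNormalWord S w} =>
      (TwoSidedIdeal.span S).ringCon.mkₐ (α := K) (word K w.1) := by
  have hli : LinearIndependent K fun w : {w // IsNormalWord S w} => word K w.1 := by
    have h := (FreeAlgebra.basisFreeMonoid K X).linearIndependent.comp
      (Subtype.val : {w // IsNormalWord S w} → FreeMonoid X) Subtype.val_injective
    simpa only [Function.comp_def, ← word_eq_basis] using h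
  refine hli.map (f := ((TwoSidedIdeal.span S).ringCon.mkₐ (α := K)).toLinearMap) ?_
  rw [Submodule.disjoint_def]
  intro f hf hf'
  have hU : (Set.range fun w : {w // IsNormalWord S w} => word K w.1) =
      word K '' {w | IsNormalWord S w} := by
    rw [Set.image_eq_range]
    rfl
  rw [hU, mem_span_word_iff] at hf
  by_contra hf0
  obtain ⟨w, hw, hn⟩ := hS.exists_not_isNormalWord
    (mem_multiplesIn_univ_of_mem_span ((mkₐ_eq_zero_iff (K := K)).1 hf')) hf0
  exact hn (hf w hw)

theorem span_normalWords [WellFoundedLT X] (S : Set (FreeAlgebra K X)) :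
    Submodule.span K (Set.range fun w : {w // IsNormalWord S w} =>
      (TwoSidedIdeal.span S).ringCon.mkₐ (α := K) (word K w.1)) = ⊤ := by
  set π := (TwoSidedIdeal.span S).ringCon.mkₐ (α := K) with hπ
  set N := Submodule.span K (Set.range fun w : {w // IsNormalWord S w} => π (word K w.1)) with hN
  have key : ∀ w : FreeMonoid X, π (word K w) ∈ N := by
    intro w
    refine DegLexLT.wellFounded.induction (C := fun w => π (word K w) ∈ N) w fun w ih => ?_
    by_cases hw : IsNormalWord S w
    · exact Submodule.subset_span ⟨⟨w, hw⟩, rfl⟩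
    simp only [IsNormalWord, not_forall, not_not] at hw
    obtain ⟨s, hs, u, hu, a, b, rfl⟩ := hw
    -- modulo the ideal, `w` is a combination of smaller words
    have hle : below K (a * u * b) ≤ N.comap π.toLinearMap := by
      refine Submodule.span_le.2 ?_
      rintro _ ⟨v, hv, rfl⟩
      exact ih v hv
    have h : π (word K a * ((wordCoeff s u)⁻¹ • s - word K u) * word K b) ∈ N :=
      hle (mul_mem_below hu.sub_mem a b)
    have hs0 : π s = 0 := mkₐ_eq_zero_iff.2 (TwoSidedIdeal.subset_span hs)
    rw [map_mul, map_mul, map_sub, map_smul, hs0, smul_zero, zero_sub, mul_neg, neg_mul,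
      neg_mem_iff, ← map_mul, ← map_mul, ← word_mul, ← word_mul] at h
    exact h
  rw [eq_top_iff]
  rintro x -
  obtain ⟨f, rfl⟩ : ∃ f, π f = x := RingCon.mkₐ_surjective _ x
  have hle : Submodule.span K (Set.range (word K (X := X))) ≤ N.comap π.toLinearMap := by
    refine Submodule.span_le.2 ?_
    rintro _ ⟨w, rfl⟩
    exact key w
  exact hle (mem_span_range_word f)

/-- The composition-diamond lemma: if `S` is a Gröbner–Shirshov basis, then the classes of the
normal words form a basis of `K⟨X⟩ / ⟨S⟩`. -/
def IsGroebnerShirshov.normalWordsBasis [WellFoundedLT X] (hS : IsGroebnerShirshov S) :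
    Module.Basis {w // IsNormalWord S w} K (TwoSidedIdeal.span S).ringCon.Quotient :=
  Module.Basis.mk hS.linearIndependent_normalWords (span_normalWords S).ge

theorem IsGroebnerShirshov.normalWordsBasis_apply [WellFoundedLT X] (hS : IsGroebnerShirshov S)
    (w : {w // IsNormalWord S w}) :
    hS.normalWordsBasis w = (TwoSidedIdeal.span S).ringCon.mkₐ (α := K) (word K w.1) :=
  Module.Basis.mk_apply _ _ w

end NormalWords

/-! ### The defining relations of the quantized matrix algebra -/

section Relations

variable {K : Type*} [Field K] {n : ℕ}

/-- The right-hand side of the defining relation `D_{ij} D_{st} = …` for rows `s ≤ i`: the element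
of `K⟨D⟩` by which the word `D_{ij} D_{st}` is replaced when `(s, t) < (i, j)`. -/
def reduct (q : K) (i j s t : Fin n) : FreeAlgebra K (Idx n) :=
  if i = s then D K s t * D K i j
  else if j ≤ t then q • (D K s t * D K i j)
  else D K s t * D K i j + (q - 1) • (D K s j * D K i t)

/-- The coefficient of `D_{st} D_{ij}` in the defining relation for rows `s < i`. -/
def swapCoeff (q : K) (j t : Fin n) : K := if j ≤ t then q else 1

/-- The coefficient of `D_{sj} D_{it}` in the defining relation for rows `s < i`. -/
def crossCoeff (q : K) (j t : Fin n) : K := if j ≤ t then 0 else q - 1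

theorem reduct_of_lt (q : K) {i j s t : Fin n} (h : s < i) :
    reduct q i j s t = swapCoeff q j t • (D K s t * D K i j) +
      crossCoeff q j t • (D K s j * D K i t) := by
  unfold reduct swapCoeff crossCoeff
  rw [if_neg h.ne']
  split_ifs <;> simp

theorem reduct_self (q : K) (i j t : Fin n) : reduct q i j i t = D K i t * D K i j :=
  if_pos rfl

theorem word_pair (i j s t : Fin n) :
    word K (FreeMonoid.of (toLex (i, j) : Idx n) * FreeMonoid.of (toLex (s, t))) =
      D K i j * D K s t := by
  rw [word_mul]
  simp [word, D]

theorem degLexLT_pair {x y z w : Idx n} (h : x < z) :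
    DegLexLT (FreeMonoid.of x * FreeMonoid.of y) (FreeMonoid.of z * FreeMonoid.of w) :=
  List.Shortlex.of_lex (s := [x, y]) (t := [z, w]) rfl (.rel h)

theorem reduct_mem_below (q : K) {i j s t : Fin n} (h : toLex (s, t) < toLex (i, j)) :
    reduct q i j s t ∈
      below K (FreeMonoid.of (toLex (i, j) : Idx n) * FreeMonoid.of (toLex (s, t))) := by
  have h₁ : D K s t * D K i j ∈
      below K (FreeMonoid.of (toLex (i, j) : Idx n) * FreeMonoid.of (toLex (s, t))) := by
    rw [← word_pair]
    exact word_mem_below (degLexLT_pair h)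
  rcases Prod.Lex.toLex_lt_toLex.1 h with hs | ⟨hs, -⟩
  · have h₂ : D K s j * D K i t ∈
        below K (FreeMonoid.of (toLex (i, j) : Idx n) * FreeMonoid.of (toLex (s, t))) := by
      rw [← word_pair]
      exact word_mem_below (degLexLT_pair (Prod.Lex.toLex_lt_toLex.2 (.inl hs)))
    rw [reduct_of_lt q hs]
    exact add_mem (Submodule.smul_mem _ _ h₁) (Submodule.smul_mem _ _ h₂)
  · obtain rfl : s = i := hs
    rwa [reduct_self]

theorem isLeadingWord_sub_reduct (q : K) {i j s t : Fin n} (h : toLex (s, t) < toLex (i, j)) :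
    IsLeadingWord (D K i j * D K s t - reduct q i j s t)
      (FreeMonoid.of (toLex (i, j)) * FreeMonoid.of (toLex (s, t))) := by
  refine (isLeadingWord_of_sub_mem one_ne_zero ?_).2
  rw [one_smul, word_pair, sub_sub_cancel_left, neg_mem_iff]
  exact reduct_mem_below q h

theorem sub_reduct_mem_relations (q : K) {i j s t : Fin n} (h : s ≤ i) :
    D K i j * D K s t - reduct q i j s t ∈ relations n q := by
  rcases h.lt_or_eq with h | rfl
  · by_cases hjt : j ≤ t
    · refine .inl (.inl ⟨i, j, s, t, h, hjt, ?_⟩)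
      rw [reduct, if_neg h.ne', if_pos hjt]
    · refine .inl (.inr ⟨i, j, s, t, h, not_le.1 hjt, ?_⟩)
      rw [reduct, if_neg h.ne', if_neg hjt, sub_sub]
  · exact .inr ⟨s, j, t, by rw [reduct_self]⟩

/-- Every nonzero defining relation is, once made monic, of the form `D_{ij} D_{st} - …` for
indices `(s, t) < (i, j)`, and is determined by its leading word `D_{ij} D_{st}`. -/
theorem exists_eq_of_isLeadingWord {q : K} {f : FreeAlgebra K (Idx n)} (hf : f ∈ relations n q)
    {u : FreeMonoid (Idx n)} (hu : IsLeadingWord f u) :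
    ∃ i j s t : Fin n, toLex (s, t) < toLex (i, j) ∧
      u = FreeMonoid.of (toLex (i, j)) * FreeMonoid.of (toLex (s, t)) ∧
      (wordCoeff f u)⁻¹ • f = D K i j * D K s t - reduct q i j s t := by
  have main : ∀ {i j s t : Fin n} {c : K}, c ≠ 0 → toLex (s, t) < toLex (i, j) →
      f = c • (D K i j * D K s t - reduct q i j s t) → ∃ i j s t : Fin n,
      toLex (s, t) < toLex (i, j) ∧
      u = FreeMonoid.of (toLex (i, j)) * FreeMonoid.of (toLex (s, t)) ∧
      (wordCoeff f u)⁻¹ • f = D K i j * D K s t - reduct q i j s t := by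
    intro i j s t c hc h hfc
    have hlead : wordCoeff f (FreeMonoid.of (toLex (i, j)) * FreeMonoid.of (toLex (s, t))) = c ∧
        IsLeadingWord f (FreeMonoid.of (toLex (i, j)) * FreeMonoid.of (toLex (s, t))) := by
      refine isLeadingWord_of_sub_mem hc ?_
      rw [hfc, word_pair, ← smul_sub, sub_sub_cancel_left]
      exact Submodule.smul_mem _ _ (neg_mem (reduct_mem_below q h))
    obtain rfl := hu.unique hlead.2
    refine ⟨i, j, s, t, h, rfl, ?_⟩
    rw [hlead.1]
    nth_rewrite 1 [hfc]
    exact inv_smul_smul₀ hc _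
  rcases hf with (⟨i, j, s, t, hs, hjt, hf⟩ | ⟨i, j, s, t, hs, hjt, hf⟩) | ⟨i, j, k, hf⟩
  · refine main (i := i) (j := j) (s := s) (t := t) one_ne_zero
      (Prod.Lex.toLex_lt_toLex.2 (.inl hs)) ?_
    rw [one_smul, hf, reduct, if_neg hs.ne', if_pos hjt]
  · refine main (i := i) (j := j) (s := s) (t := t) one_ne_zero
      (Prod.Lex.toLex_lt_toLex.2 (.inl hs)) ?_
    rw [one_smul, hf, reduct, if_neg hs.ne', if_neg hjt.not_ge, sub_sub]
  · rcases lt_trichotomy j k with hjk | rfl | hjk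
    · refine main (i := i) (j := k) (s := i) (t := j) (c := -1) (neg_ne_zero.2 one_ne_zero)
        (Prod.Lex.toLex_lt_toLex.2 (.inr ⟨rfl, hjk⟩)) ?_
      rw [reduct_self, hf, neg_one_smul, neg_sub]
    · rw [sub_self] at hf
      exact absurd (by simp [hf, wordCoeff]) hu.1
    · refine main (i := i) (j := j) (s := i) (t := k) one_ne_zero
        (Prod.Lex.toLex_lt_toLex.2 (.inr ⟨rfl, hjk⟩)) ?_
      rw [reduct_self, hf, one_smul]

end Relations

/-! ### The compositions of the defining relations -/

section Compositions

variable {K : Type*} [Field K] {n : ℕ}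

theorem degLexLT_triple {x y z p r s : Idx n} (h : p < x ∨ p = x ∧ r < y) :
    DegLexLT (FreeMonoid.of p * FreeMonoid.of r * FreeMonoid.of s)
      (FreeMonoid.of x * FreeMonoid.of y * FreeMonoid.of z) := by
  refine List.Shortlex.of_lex (s := [p, r, s]) (t := [x, y, z]) rfl ?_
  rcases h with h | ⟨rfl, h⟩
  · exact .rel h
  · exact .cons (.rel h)

theorem sub_reduct_mul_mem (q : K) {x y z : Idx n} {i j s t : Fin n} (l m : Fin n)
    (h : toLex (s, t) < toLex (i, j))
    (hb : toLex (i, j) < x ∨ toLex (i, j) = x ∧ toLex (s, t) < y) :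
    (D K i j * D K s t - reduct q i j s t) * D K l m ∈
      trivialMod (relations n q) (FreeMonoid.of x * FreeMonoid.of y * FreeMonoid.of z) := by
  have := mem_trivialMod (a := 1) (b := FreeMonoid.of (toLex (l, m)))
    (w := FreeMonoid.of x * FreeMonoid.of y * FreeMonoid.of z)
    (sub_reduct_mem_relations q (Prod.Lex.monotone_fst _ _ h.le))
    (isLeadingWord_sub_reduct q h)
    (by rw [one_mul]; exact degLexLT_triple hb)
  simpa [word, D] using this

theorem mul_sub_reduct_mem (q : K) {x y z : Idx n} (i j : Fin n) {s t l m : Fin n}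
    (h : toLex (l, m) < toLex (s, t))
    (hb : toLex (i, j) < x ∨ toLex (i, j) = x ∧ toLex (s, t) < y) :
    D K i j * (D K s t * D K l m - reduct q s t l m) ∈
      trivialMod (relations n q) (FreeMonoid.of x * FreeMonoid.of y * FreeMonoid.of z) := by
  have := mem_trivialMod (a := FreeMonoid.of (toLex (i, j))) (b := 1)
    (w := FreeMonoid.of x * FreeMonoid.of y * FreeMonoid.of z)
    (sub_reduct_mem_relations q (Prod.Lex.monotone_fst _ _ h.le))
    (isLeadingWord_sub_reduct q h)
    (by rw [mul_one, ← mul_assoc]; exact degLexLT_triple hb)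
  simpa [word, D] using this

/-- Commutators inside a row that is smaller than the row of the first letter `x` of the bounding
word are available in both orders of the columns. -/
theorem commutator_mul_mem (q : K) {x y z : Idx n} {i : Fin n} (j t l m : Fin n)
    (hb : i < (ofLex x).1) :
    (D K i j * D K i t - D K i t * D K i j) * D K l m ∈
      trivialMod (relations n q) (FreeMonoid.of x * FreeMonoid.of y * FreeMonoid.of z) := by
  have hlt : ∀ c, toLex (i, c) < x := fun c => Prod.Lex.lt_iff.2 (.inl hb)
  rcases lt_trichotomy j t with h | rfl | h
  · have := sub_reduct_mul_mem q (y := y) (z := z) l m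
      (Prod.Lex.toLex_lt_toLex.2 (.inr ⟨rfl, h⟩ : i < i ∨ i = i ∧ j < t)) (.inl (hlt t))
    rw [reduct_self] at this
    rwa [← neg_mem_iff, ← neg_mul, neg_sub]
  · simp
  · have := sub_reduct_mul_mem q (y := y) (z := z) l m
      (Prod.Lex.toLex_lt_toLex.2 (.inr ⟨rfl, h⟩ : i < i ∨ i = i ∧ t < j)) (.inl (hlt j))
    rwa [reduct_self] at this

theorem mul_commutator_mem (q : K) {x y z : Idx n} {i : Fin n} (j s t m : Fin n)
    (hb : i < (ofLex x).1) :
    D K i j * (D K s t * D K s m - D K s m * D K s t) ∈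
      trivialMod (relations n q) (FreeMonoid.of x * FreeMonoid.of y * FreeMonoid.of z) := by
  have hlt : toLex (i, j) < x := Prod.Lex.lt_iff.2 (.inl hb)
  rcases lt_trichotomy t m with h | rfl | h
  · have := mul_sub_reduct_mem q (y := y) (z := z) i j
      (Prod.Lex.toLex_lt_toLex.2 (.inr ⟨rfl, h⟩ : s < s ∨ s = s ∧ t < m)) (.inl hlt)
    rw [reduct_self] at this
    rwa [← neg_mem_iff, ← mul_neg, neg_sub]
  · simp
  · have := mul_sub_reduct_mem q (y := y) (z := z) i j
      (Prod.Lex.toLex_lt_toLex.2 (.inr ⟨rfl, h⟩ : s < s ∨ s = s ∧ m < t)) (.inl hlt)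
    rwa [reduct_self] at this

/-- The composition at a word `X Y Z` with letters from three distinct rows. -/
theorem composition_rows_distinct (q : K) {i s l : Fin n} (j t m : Fin n) (hi : s < i)
    (hs : l < s) :
    (D K i j * D K s t - reduct q i j s t) * D K l m -
      D K i j * (D K s t * D K l m - reduct q s t l m) ∈
      trivialMod (relations n q) (FreeMonoid.of (toLex (i, j)) * FreeMonoid.of (toLex (s, t)) *
        FreeMonoid.of (toLex (l, m))) := by
  have hli : l < i := hs.trans hi
  set W := trivialMod (relations n q) (FreeMonoid.of (toLex (i, j)) *
    FreeMonoid.of (toLex (s, t)) * FreeMonoid.of (toLex (l, m))) with hW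
  have lt : ∀ {a b : Fin n} (c d : Fin n), a < b → toLex (a, c) < toLex (b, d) :=
    fun c d h => Prod.Lex.toLex_lt_toLex.2 (.inl h)
  have Lx : ∀ a b c, D K s a * (D K i b * D K l c - reduct q i b l c) ∈ W := fun a b c =>
    mul_sub_reduct_mem q s a (lt c b hli) (.inl (lt _ _ hi))
  have Lz : ∀ a b c, (D K s a * D K l b - reduct q s a l b) * D K i c ∈ W := fun a b c =>
    sub_reduct_mul_mem q i c (lt b a hs) (.inl (lt _ _ hi))
  have Ry : ∀ b c, (D K i j * D K l b - reduct q i j l b) * D K s c ∈ W := fun b c =>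
    sub_reduct_mul_mem q s c (lt b j hli) (.inr ⟨rfl, lt _ _ hs⟩)
  have Rz : ∀ a b c, D K l a * (D K i b * D K s c - reduct q i b s c) ∈ W := fun a b c =>
    mul_sub_reduct_mem q l a (lt c b hi) (.inl (lt _ _ hli))
  -- the letters are sorted along the two sides of the Yang–Baxter equation
  have h := W.sub_mem
    (add_mem (add_mem (add_mem (W.smul_mem (swapCoeff q t m) (Ry m t))
      (W.smul_mem (crossCoeff q t m) (Ry t m)))
      (add_mem (W.smul_mem (swapCoeff q t m * swapCoeff q j m) (Rz m j t))
        (W.smul_mem (swapCoeff q t m * crossCoeff q j m) (Rz j m t))))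
      (add_mem (W.smul_mem (crossCoeff q t m * swapCoeff q j t) (Rz t j m))
        (W.smul_mem (crossCoeff q t m * crossCoeff q j t) (Rz j t m))))
    (add_mem (add_mem (add_mem (W.smul_mem (swapCoeff q j t) (Lx t j m))
      (W.smul_mem (crossCoeff q j t) (Lx j t m)))
      (add_mem (W.smul_mem (swapCoeff q j t * swapCoeff q j m) (Lz t m j))
        (W.smul_mem (swapCoeff q j t * crossCoeff q j m) (Lz t j m))))
      (add_mem (W.smul_mem (crossCoeff q j t * swapCoeff q t m) (Lz j m t))
        (W.smul_mem (crossCoeff q j t * crossCoeff q t m) (Lz j t m))))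
  convert h using 1
  simp only [reduct_of_lt q hi, reduct_of_lt q hs, reduct_of_lt q hli, mul_sub, sub_mul, mul_add,
    add_mul, mul_smul_comm, smul_mul_assoc, mul_assoc]
  clear h Lx Lz Ry Rz lt hW W
  rcases lt_trichotomy j t with hjt | hjt | hjt <;>
    rcases lt_trichotomy t m with htm | htm | htm <;>
    rcases lt_trichotomy j m with hjm | hjm | hjm
  all_goals first
    | omega
    | (try subst hjt
       try subst htm
       try subst hjm
       simp only [swapCoeff, crossCoeff, le_of_lt, not_le_of_gt, le_refl, if_true, if_false, *]
       module)

/-- The composition at a word `Y Y' Z` with `Y`, `Y'` from one row and `Z` from a smaller one: after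
sorting the rows, the two results differ by commutators in the row of `Y`. -/
theorem composition_first_rows_eq (q : K) {i l j t : Fin n} (m : Fin n) (hl : l < i)
    (htj : t < j) :
    (D K i j * D K i t - reduct q i j i t) * D K l m -
      D K i j * (D K i t * D K l m - reduct q i t l m) ∈
      trivialMod (relations n q) (FreeMonoid.of (toLex (i, j)) * FreeMonoid.of (toLex (i, t)) *
        FreeMonoid.of (toLex (l, m))) := by
  set W := trivialMod (relations n q) (FreeMonoid.of (toLex (i, j)) *
    FreeMonoid.of (toLex (i, t)) * FreeMonoid.of (toLex (l, m))) with hW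
  have lt : ∀ (c d : Fin n), toLex (l, c) < toLex (i, d) :=
    fun c d => Prod.Lex.toLex_lt_toLex.2 (.inl hl)
  have lt' : toLex (i, t) < toLex (i, j) := Prod.Lex.toLex_lt_toLex.2 (.inr ⟨rfl, htj⟩)
  have L₁ : D K i t * (D K i j * D K l m - reduct q i j l m) ∈ W :=
    mul_sub_reduct_mem q i t (lt m j) (.inl lt')
  have L₂ : ∀ a c, (D K i t * D K l a - reduct q i t l a) * D K i c ∈ W := fun a c =>
    sub_reduct_mul_mem q i c (lt a t) (.inl lt')
  have R : ∀ a c, (D K i j * D K l a - reduct q i j l a) * D K i c ∈ W := fun a c =>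
    sub_reduct_mul_mem q i c (lt a j) (.inr ⟨rfl, lt _ _⟩)
  have C : ∀ a b c, D K l a * (D K i b * D K i c - D K i c * D K i b) ∈ W := fun a b c =>
    mul_commutator_mem q a i b c hl
  have h := W.sub_mem
    (W.add_mem (W.add_mem (W.smul_mem (swapCoeff q t m) (R m t))
      (W.smul_mem (crossCoeff q t m) (R t m)))
      (W.add_mem (W.smul_mem (swapCoeff q j m * swapCoeff q t m) (C m j t))
        (W.smul_mem (swapCoeff q j m * crossCoeff q t m) (C t j m))))
    (W.add_mem (W.add_mem L₁ (W.smul_mem (swapCoeff q j m) (L₂ m j)))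
      (W.add_mem (W.smul_mem (crossCoeff q j m) (L₂ j m))
        (W.smul_mem (swapCoeff q t m * crossCoeff q j m) (C j t m))))
  convert h using 1
  simp only [reduct_of_lt q hl, reduct_self, mul_sub, sub_mul, mul_add,
    add_mul, mul_smul_comm, smul_mul_assoc, mul_assoc]
  clear h L₁ L₂ R C lt lt' hW W
  rcases lt_trichotomy t m with htm | htm | htm <;>
    rcases lt_trichotomy j m with hjm | hjm | hjm
  all_goals first
    | omega
    | (try subst htm
       try subst hjm
       simp only [swapCoeff, crossCoeff, le_of_lt, not_le_of_gt, le_refl, if_true, if_false, *]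
       module)

/-- The composition at a word `Y X X'` with `X`, `X'` from one row and `Y` from a larger one: after
sorting the rows, the two results differ by commutators in the row of `X`. -/
theorem composition_last_rows_eq (q : K) {i s t m : Fin n} (j : Fin n) (hs : s < i)
    (hmt : m < t) :
    (D K i j * D K s t - reduct q i j s t) * D K s m -
      D K i j * (D K s t * D K s m - reduct q s t s m) ∈
      trivialMod (relations n q) (FreeMonoid.of (toLex (i, j)) * FreeMonoid.of (toLex (s, t)) *
        FreeMonoid.of (toLex (s, m))) := by
  set W := trivialMod (relations n q) (FreeMonoid.of (toLex (i, j)) *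
    FreeMonoid.of (toLex (s, t)) * FreeMonoid.of (toLex (s, m))) with hW
  have lt : ∀ (c d : Fin n), toLex (s, c) < toLex (i, d) :=
    fun c d => Prod.Lex.toLex_lt_toLex.2 (.inl hs)
  have lt' : toLex (s, m) < toLex (s, t) := Prod.Lex.toLex_lt_toLex.2 (.inr ⟨rfl, hmt⟩)
  have M : ∀ a b c, D K s a * (D K i b * D K s c - reduct q i b s c) ∈ W := fun a b c =>
    mul_sub_reduct_mem q s a (lt c b) (.inl (lt _ _))
  have R : (D K i j * D K s m - reduct q i j s m) * D K s t ∈ W :=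
    sub_reduct_mul_mem q s t (lt m j) (.inr ⟨rfl, lt'⟩)
  have C : ∀ a b c, (D K s a * D K s b - D K s b * D K s a) * D K i c ∈ W := fun a b c =>
    commutator_mul_mem q a b i c hs
  have h := W.sub_mem
    (W.add_mem (W.add_mem (W.add_mem R (W.smul_mem (swapCoeff q j m) (M m j t)))
      (W.smul_mem (crossCoeff q j m) (M j m t)))
      (W.add_mem (W.smul_mem (swapCoeff q j m * swapCoeff q j t) (C m t j))
        (W.add_mem (W.smul_mem (swapCoeff q j t * crossCoeff q j m) (C j t m))
          (W.smul_mem (swapCoeff q j m * crossCoeff q j t) (C m j t)))))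
    (W.add_mem (W.smul_mem (swapCoeff q j t) (M t j m)) (W.smul_mem (crossCoeff q j t) (M j t m)))
  convert h using 1
  simp only [reduct_of_lt q hs, reduct_self, mul_sub, sub_mul, mul_add,
    add_mul, mul_smul_comm, smul_mul_assoc, mul_assoc]
  clear h M R C lt lt' hW W
  rcases lt_trichotomy j t with hjt | hjt | hjt <;>
    rcases lt_trichotomy j m with hjm | hjm | hjm
  all_goals first
    | omega
    | (try subst hjt
       try subst hjm
       simp only [swapCoeff, crossCoeff, le_of_lt, not_le_of_gt, le_refl, if_true, if_false, *]
       module)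

/-- The composition at a word with all three letters in one row, where the letters commute. -/
theorem composition_rows_eq (q : K) {i j t m : Fin n} (htj : t < j) (hmt : m < t) :
    (D K i j * D K i t - reduct q i j i t) * D K i m -
      D K i j * (D K i t * D K i m - reduct q i t i m) ∈
      trivialMod (relations n q) (FreeMonoid.of (toLex (i, j)) * FreeMonoid.of (toLex (i, t)) *
        FreeMonoid.of (toLex (i, m))) := by
  have lt : ∀ {c d : Fin n}, c < d → toLex (i, c) < toLex (i, d) :=
    fun h => Prod.Lex.toLex_lt_toLex.2 (.inr ⟨rfl, h⟩)
  have h := Submodule.sub_mem _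
    (add_mem (sub_reduct_mul_mem (z := toLex (i, m)) q i t (lt (hmt.trans htj))
        (.inr ⟨rfl, lt hmt⟩))
      (mul_sub_reduct_mem (y := toLex (i, t)) q i m (lt htj) (.inl (lt (hmt.trans htj)))))
    (add_mem (mul_sub_reduct_mem (y := toLex (i, t)) q i t (lt (hmt.trans htj)) (.inl (lt htj)))
      (sub_reduct_mul_mem q i j (lt hmt) (.inl (lt htj))))
  convert h using 1
  simp only [reduct_self, mul_sub, sub_mul, mul_assoc]
  abel

theorem isGroebnerShirshov_relations (n : ℕ) (q : K) : IsGroebnerShirshov (relations n q) where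
  intersection f hf g hg u v a b w hu hv hwu hwv hlen := by
    obtain ⟨i, j, s, t, h, rfl, hfu⟩ := exists_eq_of_isLeadingWord hf hu
    obtain ⟨i', j', s', t', h', rfl, hgv⟩ := exists_eq_of_isLeadingWord hg hv
    rw [← smul_mul_assoc, ← mul_smul_comm, hfu, hgv]
    have hw : (toLex (i, j) :: toLex (s, t) :: b.toList : List (Idx n)) =
        a.toList ++ [toLex (i', j'), toLex (s', t')] :=
      congrArg FreeMonoid.toList (hwu.symm.trans hwv)
    have hl : w.length < 4 := hlen
    have hwl : w.length = a.length + 2 := by simp [hwv]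
    rcases ha : a.toList with _ | ⟨x, _ | ⟨y, l⟩⟩
    · -- the two leading words coincide
      rw [ha] at hw
      simp only [List.nil_append, List.cons.injEq, EmbeddingLike.apply_eq_iff_eq,
        Prod.mk.injEq] at hw
      obtain ⟨⟨rfl, rfl⟩, ⟨rfl, rfl⟩, hb⟩ := hw
      obtain rfl : a = 1 := ha
      obtain rfl : b = 1 := hb
      simp [word_one]
    · rw [ha] at hw
      simp only [List.cons_append, List.nil_append, List.cons.injEq, EmbeddingLike.apply_eq_iff_eq,
        Prod.mk.injEq] at hw
      obtain ⟨rfl, ⟨rfl, rfl⟩, hb⟩ := hw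
      obtain rfl : a = FreeMonoid.of (toLex (i, j)) := ha
      obtain rfl : b = FreeMonoid.of (toLex (s', t')) := hb
      rw [hwu]
      have ha' : word K (FreeMonoid.of (toLex (i, j) : Idx n)) = D K i j := by simp [word, D]
      have hb' : word K (FreeMonoid.of (toLex (s', t') : Idx n)) = D K s' t' := by simp [word, D]
      rw [ha', hb']
      rcases Prod.Lex.toLex_lt_toLex.1 h with h₁ | ⟨h₁, h₁'⟩ <;>
        rcases Prod.Lex.toLex_lt_toLex.1 h' with h₂ | ⟨h₂, h₂'⟩
      · exact composition_rows_distinct q j t t' h₁ h₂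
      · obtain rfl : s' = s := h₂
        exact composition_last_rows_eq q j h₁ h₂'
      · obtain rfl : s = i := h₁
        exact composition_first_rows_eq q t' h₂ h₁'
      · obtain rfl : s = i := h₁
        obtain rfl : s' = s := h₂
        exact composition_rows_eq q h₁' h₂'
    · have : a.length = l.length + 2 := congrArg List.length ha
      omega
  inclusion f hf g hg u v a b w hu hv hwu hwv := by
    obtain ⟨i, j, s, t, h, rfl, hfu⟩ := exists_eq_of_isLeadingWord hf hu
    obtain ⟨i', j', s', t', h', rfl, hgv⟩ := exists_eq_of_isLeadingWord hg hv
    rw [← smul_mul_assoc, ← mul_smul_comm, hfu, hgv]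
    -- both leading words have length two, so they coincide
    have hlen := congrArg FreeMonoid.length (hwu.symm.trans hwv)
    simp only [FreeMonoid.length_mul, FreeMonoid.length_of] at hlen
    obtain rfl : a = 1 := FreeMonoid.length_eq_zero.1 (by omega)
    obtain rfl : b = 1 := FreeMonoid.length_eq_zero.1 (by omega)
    rw [one_mul, mul_one] at hwv
    have hw : [toLex (i, j), toLex (s, t)] = [toLex (i', j'), toLex (s', t')] :=
      congrArg FreeMonoid.toList (hwu.symm.trans hwv)
    simp only [List.cons.injEq, EmbeddingLike.apply_eq_iff_eq, Prod.mk.injEq, and_true] at hw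
    obtain ⟨⟨rfl, rfl⟩, rfl, rfl⟩ := hw
    simp [word_one]

end Compositions

/-! ### Normal words and ordered monomials -/

section OrderedMonomials

variable {K : Type*} [Field K] {n : ℕ}

theorem map_orderedProd {M N F : Type*} [Monoid M] [Monoid N] [FunLike F M N]
    [MonoidHomClass F M N] (f : F) (x : Fin n → Fin n → M) (k : Fin n → Fin n → ℕ) :
    f (orderedProd x k) = orderedProd (fun i j => f (x i j)) k := by
  simp only [orderedProd, map_list_prod, List.map_map, Function.comp_def, map_pow]

theorem isNormalWord_relations_iff (q : K) (w : FreeMonoid (Idx n)) :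
    IsNormalWord (relations n q) w ↔ w.toList.SortedLE := by
  rw [List.sortedLE_iff_isChain, List.isChain_iff_forall_rel_of_append_cons_cons]
  constructor
  · intro hw x y l₁ l₂ hl
    by_contra hlt
    exact hw _ (sub_reduct_mem_relations q (Prod.Lex.monotone_fst _ _ (not_le.1 hlt).le)) _
      (isLeadingWord_sub_reduct q (i := (ofLex x).1) (j := (ofLex x).2)
        (s := (ofLex y).1) (t := (ofLex y).2) (not_le.1 hlt))
      ⟨FreeMonoid.ofList l₁, FreeMonoid.ofList l₂, FreeMonoid.toList.injective (by simpa using hl)⟩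
  · rintro hw f hf u hu ⟨a, b, rfl⟩
    obtain ⟨i, j, s, t, h, rfl, -⟩ := exists_eq_of_isLeadingWord hf hu
    exact not_le.2 h (hw (a := toLex (i, j)) (b := toLex (s, t)) (l₁ := a.toList)
      (l₂ := b.toList) (by simp))

/-- The word `D_{11}^{k_{11}} D_{12}^{k_{12}} ⋯ D_{nn}^{k_{nn}}`. -/
def orderedWord (k : Fin n → Fin n → ℕ) : FreeMonoid (Idx n) :=
  orderedProd (fun i j : Fin n => FreeMonoid.of (toLex (i, j) : Idx n)) k

theorem toList_orderedWord (k : Fin n → Fin n → ℕ) :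
    (orderedWord k).toList = (List.finRange n).flatMap fun i =>
      (List.finRange n).flatMap fun j => List.replicate (k i j) (toLex (i, j)) := by
  have hpow : ∀ (x : Idx n) (m : ℕ), (FreeMonoid.of x ^ m).toList = List.replicate m x := by
    intro x m
    induction m with
    | zero => rfl
    | succ m ih => rw [pow_succ', FreeMonoid.toList_mul, ih]; rfl
  simp [orderedWord, orderedProd, FreeMonoid.toList_prod, List.flatMap_def, Function.comp_def, hpow]

theorem sortedLE_orderedWord (k : Fin n → Fin n → ℕ) : (orderedWord k).toList.SortedLE := by
  rw [toList_orderedWord, List.sortedLE_iff_pairwise, List.pairwise_flatMap]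
  refine ⟨fun i _ => ?_, ?_⟩
  · rw [List.pairwise_flatMap]
    refine ⟨fun j _ => List.sortedLE_iff_pairwise.1 (List.sortedLE_replicate _), ?_⟩
    refine (List.sortedLT_finRange n).pairwise.imp fun {j t} hjt x hx y hy => ?_
    rw [List.eq_of_mem_replicate hx, List.eq_of_mem_replicate hy]
    exact Prod.Lex.toLex_le_toLex.2 (.inr ⟨rfl, hjt.le⟩)
  · refine (List.sortedLT_finRange n).pairwise.imp fun {i s} his x hx y hy => ?_
    obtain ⟨j, -, hx⟩ := List.mem_flatMap.1 hx
    obtain ⟨t, -, hy⟩ := List.mem_flatMap.1 hy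
    rw [List.eq_of_mem_replicate hx, List.eq_of_mem_replicate hy]
    exact Prod.Lex.toLex_le_toLex.2 (.inl his)

theorem count_orderedWord (k : Fin n → Fin n → ℕ) (i j : Fin n) :
    (orderedWord k).toList.count (toLex (i, j)) = k i j := by
  rw [toList_orderedWord, List.count_flatMap]
  have h : ∀ s : Fin n, ((List.finRange n).flatMap fun t =>
      List.replicate (k s t) (toLex (s, t))).count (toLex (i, j)) = if s = i then k i j else 0 := by
    intro s
    rw [List.count_flatMap, Function.comp_def, ← Fin.sum_univ_def]
    by_cases hs : s = i
    · subst hs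
      simp [List.count_replicate]
    · simp [List.count_replicate, hs]
  rw [Function.comp_def, ← Fin.sum_univ_def]
  simp [h]

theorem orderedWord_injective : Function.Injective (orderedWord (n := n)) := by
  intro k k' h
  funext i j
  rw [← count_orderedWord k, h, count_orderedWord]

theorem range_orderedWord :
    Set.range (orderedWord (n := n)) = {w | w.toList.SortedLE} := by
  refine Set.Subset.antisymm (Set.range_subset_iff.2 sortedLE_orderedWord) fun w hw => ?_
  refine ⟨fun i j => w.toList.count (toLex (i, j)), FreeMonoid.toList.injective ?_⟩
  refine List.Perm.eq_of_sortedLE (sortedLE_orderedWord _) hw (List.perm_iff_count.2 fun x => ?_)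
  exact count_orderedWord _ (ofLex x).1 (ofLex x).2

theorem setOf_isNormalWord_relations (q : K) :
    {w | IsNormalWord (relations n q) w} = Set.range (orderedWord (n := n)) := by
  rw [range_orderedWord]
  ext w
  exact isNormalWord_relations_iff q w

theorem exists_basis_orderedProd (n : ℕ) (q : K) :
    ∃ B : Module.Basis (Fin n → Fin n → ℕ) K (QMatAlg n q), ∀ k, B k = orderedProd (d q) k := by
  let e : (Fin n → Fin n → ℕ) ≃ {w // IsNormalWord (relations n q) w} :=
    (Equiv.ofInjective _ orderedWord_injective).trans
      (Equiv.setCongr (setOf_isNormalWord_relations q).symm)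
  have hS := isGroebnerShirshov_relations n q
  refine ⟨hS.normalWordsBasis.reindex e.symm, fun k => ?_⟩
  refine ((Module.Basis.reindex_apply hS.normalWordsBasis e.symm k).trans
    (hS.normalWordsBasis_apply _)).trans ?_
  change (relIdeal n q).ringCon.mkₐ (α := K) (word K (orderedWord k)) = _
  rw [orderedWord, word, map_orderedProd, map_orderedProd]
  simp only [FreeMonoid.lift_eval_of]
  rfl

end OrderedMonomials

end

end QuantizedMatrix

theorem corollary2p2 {K : Type*} [Field K] [CharZero K] (n : ℕ) (hn : 2 ≤ n) (q : K) (hq : q ≠ 0) :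
    (∃ B : Module.Basis (Fin n → Fin n → ℕ) K (QuantizedMatrix.QMatAlg n q),
      ∀ k, B k = QuantizedMatrix.orderedProd (QuantizedMatrix.d q) k) ∧
    QuantizedMatrix.IsGroebnerShirshov (QuantizedMatrix.relations n q) ∧
    {w | QuantizedMatrix.IsNormalWord (QuantizedMatrix.relations n q) w} =
      Set.range (QuantizedMatrix.orderedProd
        fun i j : Fin n => FreeMonoid.of (toLex (i, j) : QuantizedMatrix.Idx n)) :=
  ⟨QuantizedMatrix.exists_basis_orderedProd n q, QuantizedMatrix.isGroebnerShirshov_relations n q,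
    QuantizedMatrix.setOf_isNormalWord_relations q⟩
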